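/- Let $n\ge 1$ and $0\le m\le n-1$ be integers. For $k\ge 1$ let $\mathcal K_k^n$ be the family of the $k^n$ cubes $\prod_{s=1}^n\left[\frac{i_s-1}{k},\frac{i_s}{k}\right]$, $i_s\in\{1,\dots,k\}$, which divide $I^n=[0,1]^n$. A set $S\subset I^n$ connects some opposite faces of $I^n$ if $S$ is connected and, for some $i\in\{1,\dots,n\}$, it contains a point with $z_i=0$ and a point with $z_i=1$. A set $P\subset\mathbb Z^{d}$ is $1$-connected if any two of its points are joined by a finite sequence of points of $P$ whose consecutive $\ell^\infty$-distances are at most $1$ (where $\mathbb Z^0=\{0\}$). Let $\dim$ denote the topological (Lebesgue covering) dimension, with $\dim\emptyset<0$. Let $\widehat C_{n,m}$ be the minimum constant $C>0$ with the following property: for every $k\ge 1$ and every $F\colon\mathcal K_k^n\to\mathbb Z^{n-1}$ such that $\|F(K_1)-F(K_2)\|_\infty\le 1$ whenever $\dim(K_1\cap K_2)\ge m$, there exist a $1$-connected set $P\subset\mathbb Z^{n-1}$ with $|P|\le C$ and a family $\mathcal S\subset F^{-1}[P]$ such that $\bigcup\mathcal S$ connects some opposite faces of $I^n$. For a graph $G$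 with vertex set $V$ and integers $c,q\ge1$, a map $f\colon V\to\{1,\dots,c\}$ is a $q$-distance clustered $c$-coloring of $G$ with constant $K>0$ if for every color $i$ all connected components of the subgraph induced by $f^{-1}[\{i\}]$ have at most $K$ vertices and the distance in $G$ between any two distinct such components is bigger than $q$. Let $\chi_{\star,q}(G)$ be the least $c\ge1$ for which such a coloring exists for some $K>0$ (and $\infty$ if there is none). If $\chi_{\star,q}(G)$ is finite, let $\widehat K_{\star,q}(G)$ be the minimum constant $K>0$ for which there is a $q$-distance clustered $\chi_{\star,q}(G)$-coloring of $G$ with constant $K$. Let $G_d^\infty$ be the graph with vertex set $\mathbb Z^d$ in which $x,y$ are adjacent if and only if $\|x-y\|_\infty=1$. Then the minimum $\widehat C_{n,m}$ exists, $\chi_{\star,m+1}(G_{n-1}^\infty)$ is finite, the minimum $\widehat K_{\star,m+1}(G_{n-1}^\infty)$ exists, and $$\widehat C_{n,m}\;\le\;\widehat K_{\star,m+1}\bigl(G_{n-1}^\infty\bigr)\;\le\;(n-1)!\,(m+1)^{n-1}.$$ -/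

import Mathlib

open Set

namespace ChessboardLevelSets

noncomputable section

/-! ### Topological (Lebesgue covering) dimension -/

/-- `X` has covering dimension less than `i`: every finite open cover of `X` has a finite open
refinement such that every point lies in at most `i` of its members. -/
def CoveringDimLT (X : Type*) [TopologicalSpace X] (i : ℕ) : Prop :=
  ∀ U : Set (Set X), U.Finite → (∀ u ∈ U, IsOpen u) → ⋃₀ U = univ →
    ∃ V : Set (Set X), V.Finite ∧ (∀ v ∈ V, IsOpen v) ∧ ⋃₀ V = univ ∧
      (∀ v ∈ V, ∃ u ∈ U, v ⊆ u) ∧ ∀ x : X, {v ∈ V | x ∈ v}.encard ≤ i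

/-- The topological dimension (Lebesgue covering dimension) of `X`. The empty space has
dimension `⊥`, which plays the role of the usual value `-1`. -/
def topDim (X : Type*) [TopologicalSpace X] : WithBot ℕ∞ :=
  sInf {d | ∀ i : ℕ, d < i → CoveringDimLT X i}

/-! ### The cubes dividing the unit cube -/

/-- The family of the `k ^ n` cubes `∏ s, [(i s - 1) / k, i s / k]`, `i s ∈ {1, …, k}`,
dividing the unit cube. -/
def cubes (n k : ℕ) : Set (Set (Fin n → ℝ)) :=
  {K | ∃ i : Fin n → ℕ, (∀ s, 1 ≤ i s ∧ i s ≤ k) ∧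
    K = univ.pi fun s => Icc (((i s : ℝ) - 1) / k) ((i s : ℝ) / k)}

/-- The unit cube `[0, 1] ^ n`. -/
def unitCube (n : ℕ) : Set (Fin n → ℝ) := univ.pi fun _ => Icc 0 1

/-- `S` is a connected subset of the unit cube that meets both `i`-th opposite faces of it,
for some `i`. -/
def ConnectsOppositeFaces {n : ℕ} (S : Set (Fin n → ℝ)) : Prop :=
  S ⊆ unitCube n ∧ IsConnected S ∧
    ∃ i : Fin n, (∃ z ∈ S, z i = 0) ∧ ∃ z ∈ S, z i = 1

/-! ### `r`-connected sets -/

/-- `S` is `r`-connected: any two points of `S` are joined by a finite sequence of points of `S`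
with consecutive distances at most `r`. -/
def RConnected {X : Type*} [MetricSpace X] (r : ℝ) (S : Set X) : Prop :=
  ∀ x ∈ S, ∀ y ∈ S, ∃ (N : ℕ) (p : Fin (N + 1) → X), (∀ j, p j ∈ S) ∧
    p 0 = x ∧ p (Fin.last N) = y ∧ ∀ j : Fin N, dist (p j.castSucc) (p j.succ) ≤ r

/-! ### The optimal constants of the combinatorial theorem -/

/-- The property of the constant `C`: for all `k ≥ 1` and all `F` from the cubes to `ℤ ^ (n - 1)`
with `‖F K₁ - F K₂‖ ≤ 1` (sup norm) whenever `dim (K₁ ∩ K₂) ≥ m`, there are a `1`-connected set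
`P` with at most `C` elements and a subfamily `S` of `F ⁻¹' P` whose union connects some
opposite faces. -/
def LevelProperty (n m : ℕ) (C : ℝ) : Prop :=
  ∀ k : ℕ, 1 ≤ k → ∀ F : cubes n k → (Fin (n - 1) → ℤ),
    (∀ K₁ K₂ : cubes n k,
      (m : WithBot ℕ∞) ≤ topDim ((K₁ : Set (Fin n → ℝ)) ∩ (K₂ : Set (Fin n → ℝ)) : Set _) →
        ‖F K₁ - F K₂‖ ≤ 1) →
    ∃ P : Set (Fin (n - 1) → ℤ), RConnected 1 P ∧ P.Finite ∧ (P.ncard : ℝ) ≤ C ∧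
      ∃ S : Set (cubes n k), S ⊆ F ⁻¹' P ∧
        ConnectsOppositeFaces (⋃ K ∈ S, (K : Set (Fin n → ℝ)))

/-- The positive constants with the above property. -/
def levelConstants (n m : ℕ) : Set ℝ := {C | 0 < C ∧ LevelProperty n m C}

/-- The optimal constant `Ĉ_{n,m}` (meaningful when `levelConstants n m` has a minimum). -/
def optC (n m : ℕ) : ℝ := sInf (levelConstants n m)

/-! ### Distance clustered colorings -/

/-- All connected components of the subgraphs induced by the color classes of `f` have at most
`K` vertices, and any two distinct components of the same color class have distance (in `G`)
bigger than `m`. -/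
def IsClusteredColoring {V : Type*} (G : SimpleGraph V) (m : ℕ) {c : ℕ} (f : V → Fin c)
    (K : ℝ) : Prop :=
  ∀ i : Fin c,
    (∀ A : (G.induce (f ⁻¹' {i})).ConnectedComponent, A.supp.Finite ∧ (A.supp.ncard : ℝ) ≤ K) ∧
    ∀ A B : (G.induce (f ⁻¹' {i})).ConnectedComponent, A ≠ B →
      ∀ u ∈ A.supp, ∀ v ∈ B.supp, (m : ℕ∞) < G.edist (u : V) (v : V)

/-- The positive constants `K` that are realised by some `m`-distance clustered `c`-coloring. -/
def clusterConstants {V : Type*} (G : SimpleGraph V) (m c : ℕ) : Set ℝ :=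
  {K | 0 < K ∧ ∃ f : V → Fin c, IsClusteredColoring G m f K}

/-- The `m`-distance clustered chromatic number: the least `c ≥ 1` for which an `m`-distance
clustered `c`-coloring exists, and `⊤` if there is none. -/
def clusteredChromaticNumber {V : Type*} (G : SimpleGraph V) (m : ℕ) : ℕ∞ :=
  ⨅ c ∈ {c : ℕ | 1 ≤ c ∧ (clusterConstants G m c).Nonempty}, (c : ℕ∞)

/-- The positive constants realised by the `m`-distance clustered colorings of `G` with exactly as
many colors as the `m`-distance clustered chromatic number (when that is finite). -/
def optimalClusterConstants {V : Type*} (G : SimpleGraph V) (m : ℕ) : Set ℝ :=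
  clusterConstants G m (clusteredChromaticNumber G m).toNat

/-- The optimal constant `K̂_{⋆,m}(G)` (meaningful when the chromatic number is finite). -/
def optK {V : Type*} (G : SimpleGraph V) (m : ℕ) : ℝ := sInf (optimalClusterConstants G m)

/-- The graph on `ℤ ^ n` in which two points are adjacent when their sup-norm distance is `1`. -/
def gridGraph (n : ℕ) : SimpleGraph (Fin n → ℤ) where
  Adj x y := ‖x - y‖ = 1
  symm := ⟨fun x y h => by rwa [norm_sub_rev]⟩
  loopless := ⟨fun x h => by simp at h⟩

end

end ChessboardLevelSets

namespace ChessboardLevelSets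

/-! Write d = n - 1 and let f be an (m+1)-distance clustered coloring of ℤ^d by n colors. Coloring
each cube K by f (F K) and applying the chessboard theorem (`exists_monochromatic_walk`) yields a
monochromatic king's walk between opposite faces. Touching cubes are joined by m + 1 steps through
cubes meeting in dimension at least m (`edist_le_of_touching`), so consecutive cubes of the walk
have F-values at distance at most m + 1. Having the same color, these values lie in the same
component of the color class. That component is P, so any constant of f bounds the minimum
(`levelProperty_of_isClusteredColoring`).

The chessboard theorem also shows that d colors cannot suffice on ℤ^d, since it forces arbitrarily
large components. Conversely, d + 1 colors suffice: `exists_brick_coloring` builds clusters inside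
parts of size at most d!, and replacing every lattice point by a box of side q = m + 1 separates
them by more than q and multiplies the size by q^d. Hence the chromatic number is exactly n, and the
explicit constant is d! (m+1)^d.

Sperner's lemma underlies both the chessboard theorem and the lower bound for covering dimension. -/

/-! ### Sperner's lemma on the cube -/

/-- The number of ways, modulo `2`, in which `a` is a bijection (a `0`-`1` determinant). -/
def bijParity {n : ℕ} (a : Fin n → Fin n) : ZMod 2 :=
  (Matrix.of fun r c => if a r = c then (1 : ZMod 2) else 0).det

/-- The number of ways, modulo `2`, in which `b` is a bijection onto the nonzero labels. -/
def facetParity {n : ℕ} (b : Fin n → Fin (n + 1)) : ZMod 2 :=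
  (Matrix.of fun r c : Fin n => if b r = c.succ then (1 : ZMod 2) else 0).det

theorem surjective_of_bijParity_ne_zero {n : ℕ} {a : Fin n → Fin n} (h : bijParity a ≠ 0) :
    Function.Surjective a := by
  intro c
  by_contra hc
  push Not at hc
  exact h (Matrix.det_eq_zero_of_column_eq_zero c fun r => by simp [hc r])

theorem facetParity_eq_zero {n : ℕ} {b : Fin n → Fin (n + 1)} (c : Fin n)
    (h : ∀ r, b r ≠ c.succ) : facetParity b = 0 :=
  Matrix.det_eq_zero_of_column_eq_zero c fun r => by simp [h r]

theorem facetParity_succ {n : ℕ} (a : Fin n → Fin n) :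
    facetParity (fun r => (a r).succ) = bijParity a := by
  simp [facetParity, bijParity]

/-- Each row of the 0-1 matrix contains a single 1, so adding all columns to column 0 turns it into
the all-ones column without changing the determinant. Expanding along it gives the minors on the
nonzero labels, and signs vanish modulo 2. This is the Sperner count of facets carrying all nonzero
labels. -/
theorem bijParity_eq_sum_facetParity {n : ℕ} (a : Fin (n + 1) → Fin (n + 1)) :
    bijParity a = ∑ j : Fin (n + 1), facetParity (fun r => a (j.succAbove r)) := by
  set M : Matrix (Fin (n + 1)) (Fin (n + 1)) (ZMod 2) :=
    Matrix.of fun r c => if a r = c then (1 : ZMod 2) else 0 with hM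
  have h1 := Matrix.det_updateCol_sum M 0 (fun _ => 1)
  rw [one_smul] at h1
  have h2 : bijParity a = M.det := rfl
  rw [h2, ← h1, Matrix.det_succ_column_zero]
  refine Finset.sum_congr rfl fun j _ => ?_
  have h3 : ((-1 : ZMod 2)) ^ (j : ℕ) = 1 := by
    have : (-1 : ZMod 2) = 1 := by decide
    rw [this, one_pow]
  rw [h3, Matrix.updateCol_self, one_mul]
  have h4 : ∑ k, (1 : ZMod 2) • M j k = 1 := by simp [hM]
  rw [h4, one_mul, facetParity]
  congr 1

/-- The vertices of the simplices of the Freudenthal triangulation: `τ i` is the time at which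
the `i`-th coordinate is increased. -/
def simplexVertex {n : ℕ} (x : Fin n → ℕ) (τ : Equiv.Perm (Fin n)) (j : ℕ) : Fin n → ℕ :=
  fun i => x i + if (τ i : ℕ) < j then 1 else 0

/-- The grid of the lower corners of the cells of `{0, …, k} ^ n`. -/
def cornerGrid (n k : ℕ) : Finset (Fin n → ℕ) := Fintype.piFinset fun _ => Finset.range k

theorem mem_cornerGrid {n k : ℕ} {x : Fin n → ℕ} : x ∈ cornerGrid n k ↔ ∀ i, x i < k := by
  simp [cornerGrid]

theorem simplexVertex_le {n k : ℕ} {x : Fin n → ℕ} (hx : x ∈ cornerGrid n k)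
    (τ : Equiv.Perm (Fin n)) (j : ℕ) (i : Fin n) : simplexVertex x τ j i ≤ k := by
  have := mem_cornerGrid.1 hx i
  unfold simplexVertex
  split_ifs <;> omega

/-- The contribution of the facets opposite to an inner vertex cancels. -/
theorem sum_facetParity_inner {n : ℕ} (l : (Fin (n + 1) → ℕ) → Fin (n + 2))
    (x : Fin (n + 1) → ℕ) (j : Fin n) :
    ∑ τ : Equiv.Perm (Fin (n + 1)),
      facetParity (fun r => l (simplexVertex x τ (j.succ.castSucc.succAbove r : Fin (n + 2)))) =
        0 := by
  -- Exchanging the times j and j + 1 moves only vertex j + 1, so the two simplices share the facet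
  -- opposite to it and their contributions cancel in pairs.
  set s : Equiv.Perm (Fin (n + 1)) := Equiv.swap j.castSucc j.succ with hs
  have hne : j.castSucc ≠ j.succ := by simp [Fin.ext_iff]
  refine Finset.sum_involution (fun τ _ => s * τ) ?_ ?_ (fun _ _ => Finset.mem_univ _) ?_
  · intro τ _
    have : ∀ r : Fin (n + 1), simplexVertex x (s * τ) (j.succ.castSucc.succAbove r : Fin (n + 2))
        = simplexVertex x τ (j.succ.castSucc.succAbove r : Fin (n + 2)) := by
      intro r
      funext i
      have hr : ((j.succ.castSucc.succAbove r : Fin (n + 2)) : ℕ) ≠ (j : ℕ) + 1 := by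
        have := Fin.succAbove_ne j.succ.castSucc r
        simpa [Fin.ext_iff] using this
      unfold simplexVertex
      congr 1
      refine if_congr ?_ rfl rfl
      rw [Equiv.Perm.mul_apply, hs]
      by_cases h1 : τ i = j.castSucc
      · rw [h1, Equiv.swap_apply_left, Fin.val_succ, Fin.val_castSucc]; omega
      by_cases h2 : τ i = j.succ
      · rw [h2, Equiv.swap_apply_right, Fin.val_succ, Fin.val_castSucc]; omega
      rw [Equiv.swap_apply_of_ne_of_ne h1 h2]
    simp only [this]
    exact CharTwo.add_self_eq_zero _
  · intro τ _ _ h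
    have h' : s = 1 := by simpa using h
    exact hne (Equiv.swap_eq_one_iff.1 h')
  · intro τ _
    simp [hs, ← mul_assoc]

/-- The contributions of the facets opposite to the first and the last vertices cancel, except
for those in the face `x 0 = k + 1`. -/
theorem sum_facetParity_outer {n k : ℕ} (l : (Fin (n + 1) → ℕ) → Fin (n + 2))
    (h0 : ∀ x : Fin (n + 1) → ℕ, (∀ i, x i ≤ k) → ∀ i, x i = k → l x ≠ i.castSucc)
    (h1 : ∀ x : Fin (n + 1) → ℕ, (∀ i, x i ≤ k) → ∀ i, x i = 0 → l x ≠ Fin.last _) :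
    (∑ p ∈ cornerGrid (n + 1) k ×ˢ (Finset.univ : Finset (Equiv.Perm (Fin (n + 1)))),
      facetParity (fun r : Fin (n + 1) => l (simplexVertex p.1 p.2 (r + 1)))) +
    (∑ p ∈ cornerGrid (n + 1) k ×ˢ (Finset.univ : Finset (Equiv.Perm (Fin (n + 1)))),
      facetParity (fun r : Fin (n + 1) => l (simplexVertex p.1 p.2 r))) =
    ∑ p ∈ (cornerGrid (n + 1) k ×ˢ (Finset.univ : Finset (Equiv.Perm (Fin (n + 1))))).filter
        (fun p => p.2 0 = 0 ∧ p.1 0 + 1 = k),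
      facetParity (fun r : Fin (n + 1) => l (simplexVertex p.1 p.2 (r + 1))) := by
  set B := cornerGrid (n + 1) k ×ˢ (Finset.univ : Finset (Equiv.Perm (Fin (n + 1)))) with hB
  rw [← Finset.sum_filter_add_sum_filter_not B (fun p => p.1 (p.2.symm 0) + 1 = k)]
  rw [← Finset.sum_filter_add_sum_filter_not B (fun p => p.1 (p.2.symm (Fin.last n)) = 0)
    (fun p => facetParity (fun r : Fin (n + 1) => l (simplexVertex p.1 p.2 r)))]
  -- These facets lie in a face where the coordinate increased last is 0, so the last label is
  -- missing.
  have hz : ∑ p ∈ B.filter (fun p => p.1 (p.2.symm (Fin.last n)) = 0),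
      facetParity (fun r : Fin (n + 1) => l (simplexVertex p.1 p.2 r)) = 0 := by
    refine Finset.sum_eq_zero fun p hp => ?_
    rw [Finset.mem_filter, hB, Finset.mem_product] at hp
    refine facetParity_eq_zero (Fin.last n) fun r => ?_
    refine h1 _ (simplexVertex_le hp.1.1 _ _) (p.2.symm (Fin.last n)) ?_
    unfold simplexVertex
    rw [hp.2, Equiv.apply_symm_apply, if_neg]
    have := r.2
    simp; omega
  -- These facets lie in a face `x i = k`, where label i is missing. Only i = 0 survives, because
  -- `facetParity` ignores label 0.
  have hk : ∑ p ∈ B.filter (fun p => p.1 (p.2.symm 0) + 1 = k),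
      facetParity (fun r : Fin (n + 1) => l (simplexVertex p.1 p.2 (r + 1))) =
      ∑ p ∈ B.filter (fun p => p.2 0 = 0 ∧ p.1 0 + 1 = k),
      facetParity (fun r : Fin (n + 1) => l (simplexVertex p.1 p.2 (r + 1))) := by
    symm
    refine Finset.sum_subset ?_ ?_
    · intro p hp
      rw [Finset.mem_filter] at hp ⊢
      refine ⟨hp.1, ?_⟩
      have h : p.2.symm 0 = 0 := by rw [Equiv.symm_apply_eq, hp.2.1]
      rw [h]
      exact hp.2.2
    · intro p hp hp'
      rw [Finset.mem_filter] at hp hp'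
      have hp1 := (Finset.mem_product.1 hp.1).1
      have hne : p.2.symm 0 ≠ 0 := by
        intro h
        refine hp' ⟨hp.1, ?_, ?_⟩
        · rw [← Equiv.eq_symm_apply, h]
        · have := hp.2
          rwa [h] at this
      obtain ⟨c, hc⟩ := Fin.exists_succ_eq.2 hne
      refine facetParity_eq_zero c.castSucc fun r => ?_
      rw [← Fin.castSucc_succ, hc]
      refine h0 _ (simplexVertex_le hp1 _ _) _ ?_
      unfold simplexVertex
      rw [Equiv.apply_symm_apply, if_pos (by simp)]
      exact hp.2
  -- Any other facet opposite to the first vertex is the facet opposite to the last vertex in the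
  -- adjacent cell: shift the corner along the coordinate increased first and rotate the times
  -- cyclically.
  have hr : ∑ p ∈ B.filter (fun p => ¬ p.1 (p.2.symm 0) + 1 = k),
      facetParity (fun r : Fin (n + 1) => l (simplexVertex p.1 p.2 (r + 1))) =
      ∑ p ∈ B.filter (fun p => ¬ p.1 (p.2.symm (Fin.last n)) = 0),
      facetParity (fun r : Fin (n + 1) => l (simplexVertex p.1 p.2 r)) := by
    have hlast : ∀ τ : Equiv.Perm (Fin (n + 1)),
        ((finRotate (n + 1))⁻¹ * τ).symm (Fin.last n) = τ.symm 0 := by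
      intro τ
      rw [Equiv.symm_apply_eq, Equiv.Perm.mul_apply, Equiv.apply_symm_apply,
        Equiv.Perm.eq_inv_iff_eq, finRotate_last]
    have hzero : ∀ τ : Equiv.Perm (Fin (n + 1)),
        (finRotate (n + 1) * τ).symm 0 = τ.symm (Fin.last n) := by
      intro τ
      rw [Equiv.symm_apply_eq, Equiv.Perm.mul_apply, Equiv.apply_symm_apply, finRotate_last]
    refine Finset.sum_bij'
      (fun p _ => (Function.update p.1 (p.2.symm 0) (p.1 (p.2.symm 0) + 1),
        (finRotate (n + 1))⁻¹ * p.2))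
      (fun p _ => (Function.update p.1 (p.2.symm (Fin.last n))
        (p.1 (p.2.symm (Fin.last n)) - 1), finRotate (n + 1) * p.2)) ?_ ?_ ?_ ?_ ?_
    · intro p hp
      simp only [hB, Finset.mem_filter, Finset.mem_product, mem_cornerGrid, Finset.mem_univ,
        and_true] at hp ⊢
      refine ⟨fun i => ?_, ?_⟩
      · have := hp.1 i
        by_cases hi : i = p.2.symm 0
        · subst hi
          rw [Function.update_self]
          have := hp.2
          omega
        · rwa [Function.update_of_ne hi]
      · rw [hlast, Function.update_self]; simp
    · intro p hp
      simp only [hB, Finset.mem_filter, Finset.mem_product, mem_cornerGrid, Finset.mem_univ,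
        and_true] at hp ⊢
      refine ⟨fun i => ?_, ?_⟩
      · have := hp.1 i
        by_cases hi : i = p.2.symm (Fin.last n)
        · subst hi
          rw [Function.update_self]
          omega
        · rwa [Function.update_of_ne hi]
      · rw [hzero, Function.update_self]
        have := hp.1 (p.2.symm (Fin.last n))
        have := hp.2
        omega
    · intro p hp
      simp only [hlast, Function.update_self, Function.update_idem, Nat.add_sub_cancel,
        Function.update_eq_self, mul_inv_cancel_left]
    · intro p hp
      have := (Finset.mem_filter.1 hp).2
      simp only [hzero, Function.update_self, Function.update_idem, inv_mul_cancel_left,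
        Nat.sub_add_cancel (Nat.pos_of_ne_zero this), Function.update_eq_self]
    · intro p hp
      congr 1
      funext r
      congr 1
      funext i
      simp only [simplexVertex]
      by_cases hi : i = p.2.symm 0
      · subst hi
        have e : ((finRotate (n + 1))⁻¹ * p.2) (p.2.symm 0) = Fin.last n := by
          rw [← Equiv.eq_symm_apply, hlast]
        rw [Function.update_self, e, Equiv.apply_symm_apply, if_pos (by simp),
          if_neg (by have := r.2; simp; omega)]
      · rw [Function.update_of_ne hi, Equiv.Perm.mul_apply]
        congr 1
        refine if_congr ?_ rfl rfl
        have hpi : p.2 i ≠ 0 := fun h => hi (by rw [← h, Equiv.symm_apply_apply])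
        obtain ⟨c, hc⟩ := Fin.exists_succ_eq.2 hpi
        have : (finRotate (n + 1))⁻¹ (p.2 i) = c.castSucc := by
          rw [Equiv.Perm.inv_eq_iff_eq, ← hc, finRotate_apply, Fin.coeSucc_eq_succ]
        rw [this, ← hc]
        simp
  rw [hz, hk, hr, zero_add, add_assoc, CharTwo.add_self_eq_zero, add_zero]

/-- The number of fully labelled simplices is odd. -/
theorem sum_bijParity_eq_one (n k : ℕ) (hk : 1 ≤ k) (l : (Fin n → ℕ) → Fin (n + 1))
    (h0 : ∀ x : Fin n → ℕ, (∀ i, x i ≤ k) → ∀ i, x i = k → l x ≠ i.castSucc)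
    (h1 : ∀ x : Fin n → ℕ, (∀ i, x i ≤ k) → ∀ i, x i = 0 → l x ≠ Fin.last _) :
    ∑ p ∈ cornerGrid n k ×ˢ (Finset.univ : Finset (Equiv.Perm (Fin n))),
      bijParity (fun r : Fin (n + 1) => l (simplexVertex p.1 p.2 r)) = 1 := by
  induction n with
  | zero =>
    have : cornerGrid 0 k = {default} := by
      ext x
      simp [mem_cornerGrid, Subsingleton.elim x default]
    rw [this]
    simp [bijParity, Subsingleton.elim _ (0 : Fin 1)]
  | succ n ih =>
    simp only [bijParity_eq_sum_facetParity]
    rw [Finset.sum_comm, Fin.sum_univ_succ, Fin.sum_univ_castSucc]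
    have hin : ∑ j : Fin n, ∑ p ∈ cornerGrid (n + 1) k ×ˢ
        (Finset.univ : Finset (Equiv.Perm (Fin (n + 1)))),
        facetParity (fun r =>
          l (simplexVertex p.1 p.2 (j.castSucc.succ.succAbove r : Fin (n + 2)))) = 0 := by
      refine Finset.sum_eq_zero fun j _ => ?_
      rw [Finset.sum_product]
      refine Finset.sum_eq_zero fun x _ => ?_
      have := sum_facetParity_inner l x j
      rwa [← Fin.succ_castSucc] at this
    rw [hin, zero_add]
    have := sum_facetParity_outer l h0 h1
    simp only [Fin.succAbove_zero, Fin.val_succ, Fin.succ_last, Fin.succAbove_last,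
      Fin.val_castSucc]
    rw [this]
    -- The face `x 0 = k` never carries label 0, so lowering its labels by one gives a Sperner
    -- labelling one dimension down. The default 0 is never used on the grid.
    set q : (Fin n → ℕ) → Fin (n + 1) := fun y =>
      if h : l (Fin.cons k y) ≠ 0 then (l (Fin.cons k y)).pred h else 0 with hq
    have hcons : ∀ y : Fin n → ℕ, (∀ i, y i ≤ k) → ∀ i, (Fin.cons k y : Fin (n + 1) → ℕ) i ≤ k := by
      intro y hy i
      refine Fin.cases ?_ (fun i => ?_) i
      · simp
      · simpa using hy i
    have hqs : ∀ y : Fin n → ℕ, (∀ i, y i ≤ k) → (q y).succ = l (Fin.cons k y) := by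
      intro y hy
      have hne : l (Fin.cons k y) ≠ 0 := by
        simpa using h0 (Fin.cons k y) (hcons y hy) 0 (by simp)
      simp [hq, hne]
    have ihq := ih q ?_ ?_
    · rw [← ihq]
      refine Finset.sum_bij' (fun p _ => (Fin.tail p.1, (Equiv.Perm.decomposeFin p.2).2))
        (fun p _ => (Fin.cons (k - 1) p.1, Equiv.Perm.decomposeFin.symm (0, p.2))) ?_ ?_ ?_ ?_ ?_
      · intro p hp
        simp only [Finset.mem_filter, Finset.mem_product, mem_cornerGrid, Finset.mem_univ,
          and_true] at hp ⊢
        exact fun i => hp.1 i.succ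
      · intro p hp
        simp only [Finset.mem_filter, Finset.mem_product, mem_cornerGrid, Finset.mem_univ,
          and_true] at hp ⊢
        refine ⟨fun i => ?_, ?_, ?_⟩
        · refine Fin.cases ?_ (fun i => ?_) i
          · simp; omega
          · simpa using hp i
        · simp
        · simp; omega
      · intro p hp
        obtain ⟨x, τ⟩ := p
        simp only [Finset.mem_filter] at hp
        have e1 : k - 1 = x 0 := by omega
        have e2 : (0, (Equiv.Perm.decomposeFin τ).2) = Equiv.Perm.decomposeFin τ := by
          have : (Equiv.Perm.decomposeFin τ).1 = 0 := by
            rw [← hp.2.1]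
            conv_rhs => rw [← Equiv.symm_apply_apply Equiv.Perm.decomposeFin τ]
            rw [Equiv.Perm.decomposeFin_symm_apply_zero (Equiv.Perm.decomposeFin τ).1
              (Equiv.Perm.decomposeFin τ).2]
          rw [← this]
        simp only [e1, e2, Fin.cons_self_tail, Equiv.symm_apply_apply]
      · intro p hp
        simp
      · intro p hp
        obtain ⟨x, τ⟩ := p
        simp only [Finset.mem_filter, Finset.mem_product, mem_cornerGrid] at hp
        obtain ⟨⟨c, σ⟩, rfl⟩ := Equiv.Perm.decomposeFin.symm.surjective τ
        have hc : c = 0 := by simpa using hp.2.1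
        subst hc
        rw [← facetParity_succ]
        congr 1
        funext r
        have hle : ∀ i, simplexVertex (Fin.tail x) σ r i ≤ k :=
          simplexVertex_le (mem_cornerGrid.2 fun i => hp.1.1 i.succ) _ _
        simp only [Equiv.apply_symm_apply]
        rw [hqs _ hle]
        congr 1
        funext i
        refine Fin.cases ?_ (fun i => ?_) i
        · simp [simplexVertex, hp.2.2]
        · simp [simplexVertex, Fin.tail]
    · intro y hy i hi h
      have := hqs y hy
      rw [h] at this
      refine h0 _ (hcons y hy) i.succ (by simpa using hi) ?_
      rw [← this, Fin.castSucc_succ]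
    · intro y hy i hi h
      have := hqs y hy
      rw [h] at this
      refine h1 _ (hcons y hy) i.succ (by simpa using hi) ?_
      rw [← this, Fin.succ_last]

/-- Sperner's lemma for the cube `{0, …, k} ^ n`. -/
theorem exists_fully_labelled (n k : ℕ) (hk : 1 ≤ k) (l : (Fin n → ℕ) → Fin (n + 1))
    (h0 : ∀ x : Fin n → ℕ, (∀ i, x i ≤ k) → ∀ i, x i = k → l x ≠ i.castSucc)
    (h1 : ∀ x : Fin n → ℕ, (∀ i, x i ≤ k) → ∀ i, x i = 0 → l x ≠ Fin.last _) :
    ∃ v : Fin (n + 1) → Fin n → ℕ, (∀ j, l (v j) = j) ∧ (∀ j i, v j i ≤ k) ∧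
      ∀ a b i, v a i ≤ v b i + 1 := by
  have h := sum_bijParity_eq_one n k hk l h0 h1
  obtain ⟨p, hp, hne⟩ := Finset.exists_ne_zero_of_sum_ne_zero (h.trans_ne one_ne_zero)
  choose g hg using surjective_of_bijParity_ne_zero hne
  refine ⟨fun j => simplexVertex p.1 p.2 (g j), hg,
    fun j => simplexVertex_le (Finset.mem_product.1 hp).1 _ _, fun a b i => ?_⟩
  simp only [simplexVertex]
  split_ifs <;> omega

/-! ### The chessboard theorem -/

/-- The cells `{1, …, k} ^ n` of the chessboard. -/
def InBoard {n : ℕ} (k : ℕ) (x : Fin n → ℕ) : Prop := ∀ i, 1 ≤ x i ∧ x i ≤ k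

/-- Two cells of the chessboard that touch and have the same color. -/
def BoardStep {n : ℕ} {α : Type*} (k : ℕ) (f : (Fin n → ℕ) → α) (x y : Fin n → ℕ) : Prop :=
  InBoard k x ∧ InBoard k y ∧ f x = f y ∧ ∀ i, x i ≤ y i + 1 ∧ y i ≤ x i + 1

/-- In every coloring of the `n`-dimensional chessboard by `n` colors there is a monochromatic
king's walk between two opposite faces. -/
theorem exists_monochromatic_walk {n k : ℕ} (hk : 1 ≤ k) (f : (Fin n → ℕ) → Fin n) :
    ∃ (i : Fin n) (x y : Fin n → ℕ), InBoard k x ∧ x i = 1 ∧ InBoard k y ∧ y i = k ∧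
      Relation.ReflTransGen (BoardStep k f) x y := by
  classical
  by_contra! hcon
  -- Cells reachable within their color i from the face `x i = 1`. If no walk crosses, no such cell
  -- has `x i = k`.
  let A : (Fin n → ℕ) → Prop := fun x =>
    ∃ s, InBoard k s ∧ s (f s) = 1 ∧ f s = f x ∧ Relation.ReflTransGen (BoardStep k f) s x
  -- A layer of zero coordinates is added to the board and labelled by a vanishing coordinate. In a
  -- fully labelled simplex, the vertex with the last label is an actual cell z outside `A`, while
  -- the vertex labelled by the color of z forces z into `A`.
  let l : (Fin n → ℕ) → Fin (n + 1) := fun x =>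
    if h : ∃ i, x i = 0 then h.choose.castSucc else if A x then (f x).castSucc else Fin.last n
  have hl : ∀ x i, l x = Fin.castSucc i → x i = 0 ∨ ((∀ i, x i ≠ 0) ∧ A x ∧ f x = i) := by
    intro x i h
    simp only [l] at h
    split_ifs at h with h1 h2
    · left
      rw [← Fin.castSucc_injective _ h]
      exact h1.choose_spec
    · exact Or.inr ⟨by simpa using h1, h2, Fin.castSucc_injective _ h⟩
    · exact absurd h (Fin.castSucc_ne_last _).symm
  have hl' : ∀ x, l x = Fin.last n → (∀ i, x i ≠ 0) ∧ ¬ A x := by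
    intro x h
    simp only [l] at h
    split_ifs at h with h1 h2
    · exact absurd h (Fin.castSucc_ne_last _)
    · exact absurd h (Fin.castSucc_ne_last _)
    · exact ⟨by simpa using h1, h2⟩
  have hfull := exists_fully_labelled n k hk l ?_ ?_
  · obtain ⟨v, hv, hvk, hvv⟩ := hfull
    obtain ⟨hz, hzA⟩ := hl' _ (hv (Fin.last n))
    set z := v (Fin.last n)
    have hzb : InBoard k z := fun i => ⟨Nat.pos_of_ne_zero (hz i), hvk _ i⟩
    rcases hl _ _ (hv (f z).castSucc) with h | ⟨hn, ⟨s, hs, hs1, hsf, hsw⟩, hf⟩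
    · have := hvv (Fin.last n) (f z).castSucc (f z)
      exact hzA ⟨z, hzb, le_antisymm (by simpa [h] using this) (hzb _).1, rfl, .refl⟩
    · refine hzA ⟨s, hs, hs1, hsf.trans hf, hsw.tail ⟨fun i => ⟨Nat.pos_of_ne_zero (hn i),
        hvk _ i⟩, hzb, hf, fun i => ⟨hvv _ _ _, hvv _ _ _⟩⟩⟩
  · intro x hx i hi h
    rcases hl x i h with h | ⟨hn, ⟨s, hs, hs1, hsf, hsw⟩, hf⟩
    · omega
    · rw [hsf, hf] at hs1
      exact hcon i s x hs hs1 (fun j => ⟨Nat.pos_of_ne_zero (hn j), hx j⟩) hi hsw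
  · intro x _ i hi h
    exact (hl' x h).1 i hi

/-! ### Lower bounds of the covering dimension -/

/-- A space that contains a cube of dimension `m` whose coordinates extend continuously has
covering dimension at least `m`. -/
theorem not_coveringDimLT {X : Type*} [TopologicalSpace X] {m : ℕ}
    (ψ : (Fin m → Icc (0 : ℝ) 1) → X) (hψ : Continuous ψ) (c : Fin m → X → ℝ)
    (hc : ∀ i, Continuous (c i)) (h : ∀ t i, c i (ψ t) = t i) : ¬ CoveringDimLT X m := by
  intro hX
  -- The cover encodes the Sperner boundary conditions: `u i` misses the face where coordinate i is
  -- 1, and the last set misses every face where a coordinate is 0.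
  let u : Fin (m + 1) → Set X := Fin.snoc (fun i => {x | c i x < 1}) {x | ∀ i, 0 < c i x}
  have hu1 : ∀ i : Fin m, u i.castSucc = {x | c i x < 1} := fun i => by simp [u]
  have hu2 : u (Fin.last m) = {x | ∀ i, 0 < c i x} := by simp [u]
  have hV := hX (range u) (finite_range u) ?_ ?_
  · obtain ⟨V, hVf, hVo, hVc, hVU, hVm⟩ := hV
    have hg : ∀ v : V, ∃ j, (v : Set X) ⊆ u j := by
      intro v
      obtain ⟨_, ⟨j, rfl⟩, hj⟩ := hVU v v.2
      exact ⟨j, hj⟩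
    choose g hg using hg
    obtain ⟨δ, hδ, hball⟩ := lebesgue_number_lemma_of_metric
      (c := fun v : V => ψ ⁻¹' (v : Set X)) (isCompact_univ (X := Fin m → Icc (0 : ℝ) 1))
      (fun v => (hVo v v.2).preimage hψ) (fun t _ => by
        have : ψ t ∈ ⋃₀ V := by rw [hVc]; trivial
        obtain ⟨v, hv, ht⟩ := this
        exact mem_iUnion.2 ⟨⟨v, hv⟩, ht⟩)
    choose w hw using fun t => hball t (mem_univ t)
    obtain ⟨k, hk⟩ := exists_nat_one_div_lt hδ
    let p : (Fin m → ℕ) → (Fin m → Icc (0 : ℝ) 1) := fun x i =>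
      projIcc 0 1 zero_le_one ((x i : ℝ) / ((k : ℝ) + 1))
    have hpos : (0 : ℝ) < (k : ℝ) + 1 := by positivity
    have hmem : ∀ t, ψ t ∈ u (g (w t)) := fun t => hg _ (hw t (Metric.mem_ball_self hδ))
    -- Each grid point is labelled by a cover set containing a refinement member around it. The mesh
    -- is below the Lebesgue number, so one vertex lies in the members of all m + 1 vertices;
    -- distinct labels make these members distinct.
    have hfull := exists_fully_labelled m (k + 1) (by omega) (fun x => g (w (p x))) ?_ ?_
    · obtain ⟨v, hv, -, hvv⟩ := hfull
      have hin : ∀ j, ψ (p (v 0)) ∈ (w (p (v j)) : Set X) := by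
        intro j
        refine hw (p (v j)) ?_
        rw [Metric.mem_ball]
        refine lt_of_le_of_lt ((dist_pi_le_iff (by positivity)).2 fun i => ?_) hk
        refine (abs_projIcc_sub_projIcc (h := zero_le_one)).trans ?_
        rw [← sub_div, abs_div, abs_of_pos hpos]
        gcongr
        have h1 := hvv 0 j i
        have h2 := hvv j 0 i
        rw [abs_le]
        have h1' : ((v 0 i : ℕ) : ℝ) ≤ v j i + 1 := by exact_mod_cast h1
        have h2' : ((v j i : ℕ) : ℝ) ≤ v 0 i + 1 := by exact_mod_cast h2
        constructor <;> linarith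
      have hinj : Function.Injective fun j => (w (p (v j)) : Set X) := by
        intro a b hab
        have := congrArg g (Subtype.ext hab)
        rwa [hv a, hv b] at this
      have h1 : (range fun j => (w (p (v j)) : Set X)).encard = (m + 1 : ℕ) := by
        rw [← image_univ, hinj.encard_image, encard_univ]
        simp
      have h2 := (encard_le_encard (s := range fun j => (w (p (v j)) : Set X))
        (by rintro _ ⟨j, rfl⟩; exact ⟨(w _).2, hin j⟩)).trans (hVm (ψ (p (v 0))))
      rw [h1] at h2
      have : m + 1 ≤ m := by exact_mod_cast h2
      omega
    · intro x _ i hi he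
      have := hmem (p x)
      rw [he, hu1, mem_ofPred_eq, h] at this
      simp only [p, hi] at this
      rw [projIcc_of_right_le] at this
      · simp at this
      · push_cast
        rw [div_self hpos.ne']
    · intro x _ i hi he
      have := hmem (p x)
      rw [he, hu2, mem_ofPred_eq] at this
      have := this i
      rw [h] at this
      simp only [p, hi] at this
      rw [projIcc_of_le_left] at this
      · simp at this
      · simp
  · rintro _ ⟨j, rfl⟩
    refine Fin.lastCases ?_ (fun i => ?_) j
    · rw [hu2, ofPred_forall]
      exact isOpen_iInter_of_finite fun i => isOpen_lt continuous_const (hc i)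
    · rw [hu1]
      exact isOpen_lt (hc i) continuous_const
  · refine eq_univ_of_forall fun x => ?_
    by_cases hx : ∃ i, c i x < 1
    · obtain ⟨i, hi⟩ := hx
      exact ⟨u i.castSucc, ⟨_, rfl⟩, by rw [hu1]; exact hi⟩
    · push Not at hx
      exact ⟨u (Fin.last m), ⟨_, rfl⟩, by rw [hu2]; exact fun i => zero_lt_one.trans_le (hx i)⟩

theorem le_topDim_of_not_coveringDimLT {X : Type*} [TopologicalSpace X] {m : ℕ}
    (h : ¬ CoveringDimLT X m) : (m : WithBot ℕ∞) ≤ topDim X := by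
  refine le_sInf fun d hd => ?_
  by_contra! hlt
  exact h (hd m hlt)

/-- The cube of side `1 / k` with upper corner `x / k`. -/
def gridCube {n : ℕ} (k : ℕ) (x : Fin n → ℕ) : Set (Fin n → ℝ) :=
  univ.pi fun s => Icc (((x s : ℝ) - 1) / k) ((x s : ℝ) / k)

theorem mem_gridCube {n k : ℕ} (hk : 1 ≤ k) {x : Fin n → ℕ} {z : Fin n → ℝ} :
    z ∈ gridCube k x ↔ ∀ s, (x s : ℝ) - 1 ≤ k * z s ∧ k * z s ≤ x s := by
  have hk' : (0 : ℝ) < k := by exact_mod_cast hk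
  simp only [gridCube, mem_univ_pi, mem_Icc, div_le_iff₀ hk', le_div_iff₀ hk', mul_comm]

/-- The m common coordinates range freely over an m-cube inside the intersection; each remaining
coordinate is fixed at the larger lower endpoint, which belongs to both intervals. -/
theorem le_topDim_inter_gridCube {n m k : ℕ} (hk : 1 ≤ k) {x y : Fin n → ℕ}
    (hxy : ∀ s, x s ≤ y s + 1 ∧ y s ≤ x s + 1) (e : Fin m → Fin n) (he : Function.Injective e)
    (hex : ∀ i, x (e i) = y (e i)) :
    (m : WithBot ℕ∞) ≤ topDim (gridCube k x ∩ gridCube k y : Set (Fin n → ℝ)) := by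
  have hk' : (0 : ℝ) < k := by exact_mod_cast hk
  let φ : (Fin m → Icc (0 : ℝ) 1) → (Fin n → ℝ) := fun t s =>
    (((max (x s) (y s) : ℕ) : ℝ) - 1 + Function.extend e (fun i => (t i : ℝ)) 0 s) / k
  have hφ : ∀ t s, (k : ℝ) * φ t s =
      ((max (x s) (y s) : ℕ) : ℝ) - 1 + Function.extend e (fun i => (t i : ℝ)) 0 s := by
    intro t s
    simp only [φ]
    field_simp
  have hφ' : ∀ t i, (k : ℝ) * φ t (e i) = (x (e i) : ℝ) - 1 + t i := by
    intro t i
    rw [hφ, he.extend_apply, ← hex, max_self]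
  have hmem : ∀ t, φ t ∈ gridCube k x ∩ gridCube k y := by
    intro t
    rw [mem_inter_iff, mem_gridCube hk, mem_gridCube hk, ← forall_and]
    intro s
    by_cases hs : ∃ i, e i = s
    · obtain ⟨i, rfl⟩ := hs
      rw [hφ', ← hex]
      have := (t i).2
      rw [mem_Icc] at this
      constructor <;> constructor <;> linarith
    · rw [hφ, Function.extend_apply' _ _ _ hs]
      have h1 : ((max (x s) (y s) : ℕ) : ℝ) ≤ x s + 1 := by
        have := hxy s; exact_mod_cast (by omega : max (x s) (y s) ≤ x s + 1)
      have h2 : ((max (x s) (y s) : ℕ) : ℝ) ≤ y s + 1 := by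
        have := hxy s; exact_mod_cast (by omega : max (x s) (y s) ≤ y s + 1)
      have h3 : (x s : ℝ) ≤ ((max (x s) (y s) : ℕ) : ℝ) := by exact_mod_cast le_max_left _ _
      have h4 : (y s : ℝ) ≤ ((max (x s) (y s) : ℕ) : ℝ) := by exact_mod_cast le_max_right _ _
      simp only [Pi.zero_apply]
      constructor <;> constructor <;> linarith
  refine le_topDim_of_not_coveringDimLT (not_coveringDimLT (fun t => ⟨φ t, hmem t⟩) ?_
    (fun i z => (k : ℝ) * (z : Fin n → ℝ) (e i) - ((x (e i) : ℝ) - 1)) ?_ ?_)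
  · refine Continuous.subtype_mk (continuous_pi fun s => ?_) _
    refine Continuous.div_const (continuous_const.add ?_) _
    by_cases hs : ∃ i, e i = s
    · obtain ⟨i, rfl⟩ := hs
      simp only [he.extend_apply]
      fun_prop
    · simp only [Function.extend_apply' _ _ _ hs]
      exact continuous_const
  · intro i
    exact ((continuous_const.mul ((continuous_apply (e i)).comp continuous_subtype_val)).sub
      continuous_const)
  · intro t i
    simp only
    rw [hφ']
    ring

/-! ### The brick coloring -/

/-- Shifted columns of bricks of height `D` in `D + 1` colors: touching bricks of the same color
lie in the same column position. -/
theorem brick_column {D a b g h s : ℤ} (hg : 0 ≤ g ∧ g < D) (hh : 0 ≤ h ∧ h < D)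
    (hab : |a - b| ≤ 1)
    (hs : (a - (D + 1) * g) / D - (b - (D + 1) * h) / D = (D + 1) * s) : g = h ∧ s = 0 := by
  have hD : 0 < D := by omega
  have e1 := Int.mul_ediv_add_emod (a - (D + 1) * g) D
  have e2 := Int.mul_ediv_add_emod (b - (D + 1) * h) D
  have r1 := Int.emod_nonneg (a - (D + 1) * g) hD.ne'
  have r2 := Int.emod_nonneg (b - (D + 1) * h) hD.ne'
  have r3 := Int.emod_lt_of_pos (a - (D + 1) * g) hD
  have r4 := Int.emod_lt_of_pos (b - (D + 1) * h) hD
  set p := (a - (D + 1) * g) / D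
  set q := (b - (D + 1) * h) / D
  rw [abs_le] at hab
  have hp : p = q + (D + 1) * s := by omega
  -- The right side has absolute value at most 1 + (D - 1) < D + 1, so the multiple of D + 1 is
  -- zero. Then g - h = -D s with |g - h| < D gives s = 0.
  have key : (D + 1) * (g - h + D * s) =
      a - b + (b - (D + 1) * h) % D - (a - (D + 1) * g) % D := by
    rw [hp] at e1
    linear_combination e1 - e2
  have ht : g - h + D * s = 0 := by
    by_contra hne
    rcases lt_or_gt_of_ne hne with hlt | hgt
    · have : (D + 1) * (g - h + D * s) ≤ (D + 1) * (-1) :=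
        mul_le_mul_of_nonneg_left (by omega) (by omega)
      omega
    · have : (D + 1) * 1 ≤ (D + 1) * (g - h + D * s) :=
        mul_le_mul_of_nonneg_left (by omega) (by omega)
      omega
  have hs0 : s = 0 := by
    by_contra hne
    rcases lt_or_gt_of_ne hne with hlt | hgt
    · have : D * s ≤ D * (-1) := mul_le_mul_of_nonneg_left (by omega) (by omega)
      omega
    · have : D * 1 ≤ D * s := mul_le_mul_of_nonneg_left (by omega) (by omega)
      omega
  subst hs0
  exact ⟨by simp at ht; omega, rfl⟩

/-- There are a coloring of `ℤ ^ d` by `d + 1` colors and a partition of `ℤ ^ d` into parts with at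
most `d !` elements such that touching points of the same color lie in the same part. -/
theorem exists_brick_coloring (d : ℕ) :
    ∃ (f : (Fin d → ℤ) → ZMod (d + 1)) (T : (Fin d → ℤ) → (Fin d → ℤ)),
      (∀ x y, (∀ i, |x i - y i| ≤ 1) → f x = f y → T x = T y) ∧
      ∀ x, {y | T y = T x}.Finite ∧ {y | T y = T x}.ncard ≤ d.factorial := by
  induction d with
  | zero =>
    refine ⟨fun _ => 0, id, fun x y _ _ => Subsingleton.elim _ _, fun x => ⟨toFinite _, ?_⟩⟩
    exact ncard_le_one_of_subsingleton _
  | succ d ih =>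
    obtain ⟨g, T, hT, hcard⟩ := ih
    let D : ℤ := (d : ℤ) + 1
    have hD : 0 < D := by positivity
    -- The column over each point is cut into bricks of height D, shifted according to the point's
    -- old color. A new part is an old part times a brick, which gives the factor d + 1.
    let c : (Fin (d + 1) → ℤ) → ℤ := fun x => x 0 - (D + 1) * ((g (Fin.tail x)).val : ℤ)
    refine ⟨fun x => ((c x / D : ℤ) : ZMod (d + 2)), fun x => Fin.cons (c x / D) (T (Fin.tail x)),
      ?_, ?_⟩
    · intro x y hxy hf
      have hf' := (ZMod.intCast_eq_intCast_iff_dvd_sub _ _ _).1 hf.symm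
      obtain ⟨s, hs⟩ := hf'
      have hval : ∀ z : ZMod (d + 1), 0 ≤ (z.val : ℤ) ∧ (z.val : ℤ) < D := fun z =>
        ⟨by positivity, by have := ZMod.val_lt z; simp only [D]; omega⟩
      have hs' : (x 0 - (D + 1) * ((g (Fin.tail x)).val : ℤ)) / D -
          (y 0 - (D + 1) * ((g (Fin.tail y)).val : ℤ)) / D = (D + 1) * s := by
        simp only [c, D] at hs ⊢
        rw [hs]
        push_cast
        ring
      obtain ⟨h1, h2⟩ := brick_column (hval _) (hval _) (hxy 0) hs'
      subst h2
      have h3 : T (Fin.tail x) = T (Fin.tail y) :=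
        hT _ _ (fun i => hxy i.succ) (ZMod.val_injective _ (by exact_mod_cast h1))
      have h4 : c x / D = c y / D := by
        simp only [c]
        linarith
      simp only [h3, h4]
    · intro x
      obtain ⟨hfin, hle⟩ := hcard (Fin.tail x)
      set B := {y | T y = T (Fin.tail x)}
      set E : Set (Fin (d + 1) → ℤ) := {y | (Fin.cons (c y / D) (T (Fin.tail y)) :
        Fin (d + 1) → ℤ) = Fin.cons (c x / D) (T (Fin.tail x))}
      have hmaps : ∀ y ∈ E, (Fin.tail y, c y % D) ∈ B ×ˢ (Finset.Ico 0 D : Set ℤ) := by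
        intro y hy
        have := (Fin.cons_inj.1 hy).2
        exact ⟨this, by simpa using ⟨Int.emod_nonneg _ hD.ne', Int.emod_lt_of_pos _ hD⟩⟩
      have hinj : InjOn (fun y => (Fin.tail y, c y % D)) E := by
        intro y hy z hz hyz
        have h1 : c y / D = c z / D := (Fin.cons_inj.1 hy).1.trans (Fin.cons_inj.1 hz).1.symm
        have h2 : Fin.tail y = Fin.tail z := congrArg Prod.fst hyz
        have h3 : c y % D = c z % D := congrArg Prod.snd hyz
        have h4 : c y = c z := by
          rw [← Int.mul_ediv_add_emod (c y) D, h1, h3, Int.mul_ediv_add_emod]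
        simp only [c, h2] at h4
        rw [← Fin.cons_self_tail y, ← Fin.cons_self_tail z, h2]
        congr 1
        omega
      have hfin' : (B ×ˢ (Finset.Ico 0 D : Set ℤ)).Finite := hfin.prod (Finset.finite_toSet _)
      refine ⟨Finite.of_injOn hmaps hinj hfin', ?_⟩
      refine (ncard_le_ncard_of_injOn _ hmaps hinj hfin').trans ?_
      rw [ncard_prod, ncard_coe_finset, Int.card_Ico, Nat.factorial_succ, mul_comm]
      refine Nat.mul_le_mul ?_ hle
      simp only [D]
      omega

/-! ### The grid graph -/

theorem norm_sub_le_one_iff {d : ℕ} {x y : Fin d → ℤ} :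
    ‖x - y‖ ≤ 1 ↔ ∀ i, |x i - y i| ≤ 1 := by
  rw [pi_norm_le_iff_of_nonneg zero_le_one]
  refine forall_congr' fun i => ?_
  rw [Pi.sub_apply, Int.norm_eq_abs]
  exact_mod_cast Iff.rfl

theorem gridGraph_adj_iff {d : ℕ} {x y : Fin d → ℤ} :
    (gridGraph d).Adj x y ↔ x ≠ y ∧ ∀ i, |x i - y i| ≤ 1 := by
  rw [← norm_sub_le_one_iff]
  change ‖x - y‖ = 1 ↔ _
  constructor
  · intro h
    exact ⟨by rintro rfl; simp at h, h.le⟩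
  · rintro ⟨hne, hle⟩
    refine le_antisymm hle ?_
    obtain ⟨i, hi⟩ := Function.ne_iff.1 hne
    refine le_trans ?_ (norm_le_pi_norm (x - y) i)
    rw [Pi.sub_apply, Int.norm_eq_abs]
    exact_mod_cast Int.one_le_abs (sub_ne_zero.2 hi)

theorem reachable_induce_of_near {d : ℕ} {S : Set (Fin d → ℤ)} {x y : S}
    (h : ∀ i, |(x : Fin d → ℤ) i - (y : Fin d → ℤ) i| ≤ 1) :
    ((gridGraph d).induce S).Reachable x y := by
  by_cases hxy : x = y
  · rw [hxy]
  · exact SimpleGraph.Adj.reachable (gridGraph_adj_iff.2 ⟨fun e => hxy (Subtype.ext e), h⟩)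

theorem abs_sub_le_length {d : ℕ} {x y : Fin d → ℤ} (p : (gridGraph d).Walk x y) (i : Fin d) :
    |x i - y i| ≤ p.length := by
  induction p with
  | nil => simp
  | cons h p ih =>
    rw [SimpleGraph.Walk.length_cons]
    have := (gridGraph_adj_iff.1 h).2 i
    rw [abs_le] at *
    push_cast
    omega

theorem abs_sub_le_of_edist_le {d q : ℕ} {x y : Fin d → ℤ}
    (h : (gridGraph d).edist x y ≤ q) (i : Fin d) : |x i - y i| ≤ q := by
  obtain ⟨p, hp⟩ := SimpleGraph.exists_walk_of_edist_ne_top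
    (ne_top_of_le_ne_top (ENat.natCast_ne_top q) h)
  have := abs_sub_le_length p i
  rw [← hp] at h
  have h' : p.length ≤ q := by exact_mod_cast h
  omega

/-! ### Subdivision of the cells of a coloring -/

theorem ediv_eq_iff {a q c : ℤ} (hq : 0 < q) : a / q = c ↔ c * q ≤ a ∧ a < c * q + q := by
  rw [le_antisymm_iff, ← Int.lt_add_one_iff, Int.ediv_lt_iff_lt_mul hq, Int.le_ediv_iff_mul_le hq,
    add_mul, one_mul, and_comm]

/-- Cells are boxes, so moving every coordinate one unit towards its target is a king's step that
stays in the cell. -/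
theorem reachable_of_same_cell {d : ℕ} {q : ℤ} (hq : 0 < q) {S : Set (Fin d → ℤ)}
    (hS : ∀ x y : Fin d → ℤ, (∀ i, x i / q = y i / q) → x ∈ S → y ∈ S) (N : ℕ) (x y : S)
    (hxy : ∀ i, (x : Fin d → ℤ) i / q = (y : Fin d → ℤ) i / q)
    (hN : ∀ i, |(x : Fin d → ℤ) i - (y : Fin d → ℤ) i| ≤ N) :
    ((gridGraph d).induce S).Reachable x y := by
  induction N generalizing y with
  | zero =>
    have : x = y := by
      refine Subtype.ext (funext fun i => ?_)
      have := hN i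
      rw [abs_le] at this
      push_cast at this
      omega
    rw [this]
  | succ N ih =>
    let z : Fin d → ℤ := fun i => (y : Fin d → ℤ) i +
      if (y : Fin d → ℤ) i < (x : Fin d → ℤ) i then 1
      else if (x : Fin d → ℤ) i < (y : Fin d → ℤ) i then -1 else 0
    have hz : ∀ i, z i / q = (y : Fin d → ℤ) i / q := by
      intro i
      have h1 := (ediv_eq_iff hq).1 (hxy i)
      have h2 := (ediv_eq_iff (a := (y : Fin d → ℤ) i) hq).1 rfl
      rw [ediv_eq_iff hq]
      simp only [z]
      split_ifs <;> omega
    have hzS : z ∈ S := hS y z (fun i => (hz i).symm) y.2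
    refine (ih ⟨z, hzS⟩ (fun i => (hxy i).trans (hz i).symm) fun i => ?_).trans
      (reachable_induce_of_near fun i => ?_)
    · have := hN i
      rw [abs_le] at this ⊢
      push_cast at this
      simp only [z]
      split_ifs <;> omega
    · rw [abs_le]
      simp only [z]
      split_ifs <;> omega

theorem reachable_of_near_cells {d : ℕ} {q : ℤ} (hq : 0 < q) {S : Set (Fin d → ℤ)}
    (hS : ∀ x y : Fin d → ℤ, (∀ i, x i / q = y i / q) → x ∈ S → y ∈ S) (x y : S)
    (hxy : ∀ i, |(x : Fin d → ℤ) i / q - (y : Fin d → ℤ) i / q| ≤ 1) :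
    ((gridGraph d).induce S).Reachable x y := by
  have hcell : ∀ u v : S, (∀ i, (u : Fin d → ℤ) i / q = (v : Fin d → ℤ) i / q) →
      ((gridGraph d).induce S).Reachable u v := by
    intro u v huv
    refine reachable_of_same_cell hq hS q.toNat u v huv fun i => ?_
    have h1 := (ediv_eq_iff hq).1 (huv i)
    have h2 := (ediv_eq_iff (a := (v : Fin d → ℤ) i) hq).1 rfl
    rw [abs_le]
    omega
  -- The corner of the cell of u facing the cell of v; the facing corners of touching cells are
  -- equal or adjacent.
  let corner : (Fin d → ℤ) → (Fin d → ℤ) → Fin d → ℤ := fun u v i =>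
    u i / q * q + if u i / q < v i / q then q - 1 else 0
  have hcorner : ∀ u v : Fin d → ℤ, ∀ i, u i / q = corner u v i / q := by
    intro u v i
    rw [eq_comm, ediv_eq_iff hq]
    simp only [corner]
    split_ifs <;> omega
  refine (hcell x ⟨corner x y, hS _ _ (hcorner _ _) x.2⟩ (hcorner _ _)).trans
    (SimpleGraph.Reachable.trans (reachable_induce_of_near
      (y := ⟨corner y x, hS _ _ (hcorner _ _) y.2⟩) fun i => ?_) (hcell _ y fun i => ?_))
  · have := hxy i
    rw [abs_le] at this
    simp only [corner]
    rcases lt_trichotomy ((x : Fin d → ℤ) i / q) ((y : Fin d → ℤ) i / q) with h | h | h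
    · have e : (y : Fin d → ℤ) i / q = (x : Fin d → ℤ) i / q + 1 := by omega
      rw [if_pos h, if_neg (by omega), e, add_mul, abs_le]
      constructor <;> omega
    · rw [h]
      simp
    · have e : (x : Fin d → ℤ) i / q = (y : Fin d → ℤ) i / q + 1 := by omega
      rw [if_neg (by omega), if_pos h, e, add_mul, abs_le]
      constructor <;> omega
  · exact (hcorner _ _ i).symm

theorem ncard_subdivision_le {d q M : ℕ} (hq : 1 ≤ q) {B : Set (Fin d → ℤ)} (hB : B.Finite)
    (hM : B.ncard ≤ M) : {x : Fin d → ℤ | (fun i => x i / (q : ℤ)) ∈ B}.Finite ∧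
      {x : Fin d → ℤ | (fun i => x i / (q : ℤ)) ∈ B}.ncard ≤ M * q ^ d := by
  have hq' : (0 : ℤ) < q := by exact_mod_cast hq
  let R : Finset (Fin d → ℤ) := Fintype.piFinset fun _ => Finset.Ico 0 (q : ℤ)
  have hmaps : ∀ x ∈ {x : Fin d → ℤ | (fun i => x i / (q : ℤ)) ∈ B},
      ((fun i => x i / (q : ℤ)), fun i => x i % (q : ℤ)) ∈ B ×ˢ (R : Set (Fin d → ℤ)) := by
    intro x hx
    refine ⟨hx, ?_⟩
    simp only [R, Finset.mem_coe, Fintype.mem_piFinset, Finset.mem_Ico]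
    exact fun i => ⟨Int.emod_nonneg _ hq'.ne', Int.emod_lt_of_pos _ hq'⟩
  have hinj : InjOn (fun x : Fin d → ℤ => ((fun i => x i / (q : ℤ)), fun i => x i % (q : ℤ)))
      {x : Fin d → ℤ | (fun i => x i / (q : ℤ)) ∈ B} := by
    intro x _ y _ hxy
    funext i
    have h1 : x i / (q : ℤ) = y i / q := congrFun (congrArg Prod.fst hxy) i
    have h2 : x i % (q : ℤ) = y i % q := congrFun (congrArg Prod.snd hxy) i
    rw [← Int.mul_ediv_add_emod (x i) q, h1, h2, Int.mul_ediv_add_emod]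
  have hfin : (B ×ˢ (R : Set (Fin d → ℤ))).Finite := hB.prod (Finset.finite_toSet _)
  refine ⟨Finite.of_injOn hmaps hinj hfin, (ncard_le_ncard_of_injOn _ hmaps hinj hfin).trans ?_⟩
  rw [ncard_prod, ncard_coe_finset]
  refine Nat.mul_le_mul hM (le_of_eq ?_)
  simp [R]

theorem abs_ediv_sub_ediv_le_one {a b q : ℤ} (hq : 0 < q) (h : |a - b| ≤ q) :
    |a / q - b / q| ≤ 1 := by
  have h1 : a / q ≤ b / q + 1 := by
    have := Int.add_mul_ediv_right b 1 hq.ne'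
    rw [one_mul] at this
    rw [← this]
    exact Int.ediv_le_ediv hq (by rw [abs_le] at h; omega)
  have h2 : b / q ≤ a / q + 1 := by
    have := Int.add_mul_ediv_right a 1 hq.ne'
    rw [one_mul] at this
    rw [← this]
    exact Int.ediv_le_ediv hq (by rw [abs_le] at h; omega)
  rw [abs_le]
  omega

/-- The explicit distance clustered coloring of the grid. -/
theorem exists_isClusteredColoring (d q : ℕ) (hq : 1 ≤ q) :
    ∃ f : (Fin d → ℤ) → Fin (d + 1),
      IsClusteredColoring (gridGraph d) q f (((d.factorial * q ^ d : ℕ) : ℝ)) := by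
  obtain ⟨f, T, hT, hcard⟩ := exists_brick_coloring d
  have hq' : (0 : ℤ) < q := by exact_mod_cast hq
  let φ : (Fin d → ℤ) → (Fin d → ℤ) := fun x i => x i / (q : ℤ)
  refine ⟨fun x => f (φ x), fun i => ⟨fun A => ?_, fun A B hAB u hu v hv => ?_⟩⟩
  · set S : Set (Fin d → ℤ) := (fun x => (f (φ x) : Fin (d + 1))) ⁻¹' {i} with hS
    -- The part `T (φ x)` is constant along monochromatic paths, so a component stays in the
    -- subdivision of a single part.
    have hreach : ∀ x y : S, ((gridGraph d).induce S).Reachable x y → T (φ y) = T (φ x) := by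
      rintro x y ⟨p⟩
      induction p with
      | nil => rfl
      | cons h p ih =>
        rename_i a b c
        rw [ih]
        have h' := (gridGraph_adj_iff.1 (SimpleGraph.induce_adj.1 h)).2
        refine (hT _ _ (fun j => abs_ediv_sub_ediv_le_one hq' ((h' j).trans hq')) ?_).symm
        exact (a.2 : f (φ a) = i).trans (b.2 : f (φ b) = i).symm
    obtain ⟨x, rfl⟩ := A.exists_rep
    obtain ⟨h1, h2⟩ := hcard (φ x)
    obtain ⟨h3, h4⟩ := ncard_subdivision_le hq h1 h2
    have hsub : Subtype.val '' (SimpleGraph.connectedComponentMk _ x :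
        ((gridGraph d).induce S).ConnectedComponent).supp ⊆
        {z : Fin d → ℤ | (fun i => z i / (q : ℤ)) ∈ {y | T y = T (φ x)}} := by
      rintro _ ⟨y, hy, rfl⟩
      exact hreach x y (SimpleGraph.ConnectedComponent.eq.1 hy).symm
    refine ⟨(h3.subset hsub).of_finite_image Subtype.val_injective.injOn, ?_⟩
    rw [← ncard_image_of_injective _ Subtype.val_injective]
    exact_mod_cast (ncard_le_ncard hsub h3).trans h4
  -- Points at distance at most q lie in equal or touching cells. A color class is a union of cells,
  -- so two such points of one color share a component.
  · by_contra! hle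
    refine hAB ?_
    rw [← hu, ← hv]
    refine SimpleGraph.ConnectedComponent.eq.2 (reachable_of_near_cells hq' ?_ u v fun i => ?_)
    · intro x y hxy hx
      have : φ x = φ y := funext hxy
      change f (φ y) = i
      rw [← this]
      exact hx
    · exact abs_ediv_sub_ediv_le_one hq' (abs_sub_le_of_edist_le hle i)

/-! ### Existence of the minima -/

/-- The constants bound cardinalities, so rounding down keeps them admissible, and the least
admissible natural number is the minimum. -/
theorem isLeast_sInf_of_floor {S : Set ℝ} (hne : S.Nonempty) (hpos : ∀ x ∈ S, 0 < x)
    (hfl : ∀ x ∈ S, (⌊x⌋₊ : ℝ) ∈ S) : IsLeast S (sInf S) := by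
  classical
  have hN : ∃ k : ℕ, (k : ℝ) ∈ S := let ⟨x, hx⟩ := hne; ⟨_, hfl x hx⟩
  have hleast : IsLeast S (Nat.find hN : ℝ) := by
    refine ⟨Nat.find_spec hN, fun x hx => ?_⟩
    exact (Nat.cast_le.2 (Nat.find_min' hN (hfl x hx))).trans (Nat.floor_le (hpos x hx).le)
  rwa [hleast.csInf_eq]

theorem isLeast_clusterConstants {V : Type*} [Nonempty V] {G : SimpleGraph V} {q c : ℕ}
    (hne : (clusterConstants G q c).Nonempty) :
    IsLeast (clusterConstants G q c) (sInf (clusterConstants G q c)) := by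
  refine isLeast_sInf_of_floor hne (fun x hx => hx.1) ?_
  rintro K ⟨hK, f, hf⟩
  have hone : 1 ≤ K := by
    obtain ⟨x⟩ := ‹Nonempty V›
    let A := (G.induce (f ⁻¹' {f x})).connectedComponentMk ⟨x, rfl⟩
    obtain ⟨h1, h2⟩ := (hf (f x)).1 A
    have h3 : 0 < A.supp.ncard := (ncard_pos h1).2 ⟨_, rfl⟩
    exact le_trans (by exact_mod_cast h3) h2
  refine ⟨by exact_mod_cast Nat.floor_pos.2 hone, f, fun i => ⟨fun A => ?_, (hf i).2⟩⟩
  obtain ⟨h1, h2⟩ := (hf i).1 A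
  exact ⟨h1, by exact_mod_cast Nat.le_floor h2⟩

theorem one_le_of_levelProperty {n m : ℕ} {C : ℝ} (h : LevelProperty n m C) : 1 ≤ C := by
  obtain ⟨P, -, hP, hle, S, hS, -, ⟨hne, -⟩, -⟩ := h 1 le_rfl (fun _ => 0) (fun _ _ _ => by simp)
  obtain ⟨z, hz⟩ := hne
  simp only [mem_iUnion] at hz
  obtain ⟨K, hK, -⟩ := hz
  have : 0 < P.ncard := (ncard_pos hP).2 ⟨_, hS hK⟩
  exact le_trans (by exact_mod_cast this) hle

theorem isLeast_levelConstants {n m : ℕ} (hne : (levelConstants n m).Nonempty) :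
    IsLeast (levelConstants n m) (optC n m) := by
  refine isLeast_sInf_of_floor hne (fun x hx => hx.1) ?_
  rintro C ⟨-, hC⟩
  refine ⟨by exact_mod_cast Nat.floor_pos.2 (one_le_of_levelProperty hC), fun k hk F hF => ?_⟩
  obtain ⟨P, h1, h2, h3, h4⟩ := hC k hk F hF
  exact ⟨P, h1, h2, by exact_mod_cast Nat.le_floor h3, h4⟩

/-! ### The distance clustered chromatic number of the grid -/

/-- A grid coloring with boundedly large monochromatic components needs `d + 1` colors. -/
theorem lt_of_clusterConstants_nonempty {d q c : ℕ}
    (h : (clusterConstants (gridGraph d) q c).Nonempty) : d < c := by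
  by_contra! hcd
  obtain ⟨K, hK, f, hf⟩ := h
  let ι : (Fin d → ℕ) → (Fin d → ℤ) := fun x i => (x i : ℤ)
  obtain ⟨k, hk⟩ := exists_nat_gt K
  have hk1 : 1 ≤ k := by
    have : (0 : ℝ) < k := hK.trans hk
    exact_mod_cast this
  obtain ⟨i, x, y, hx, hxi, hy, hyi, hxy⟩ :=
    exists_monochromatic_walk hk1 fun x => Fin.castLE hcd (f (ι x))
  let S : Set (Fin d → ℤ) := f ⁻¹' {f (ι x)}
  let A := ((gridGraph d).induce S).connectedComponentMk ⟨ι x, rfl⟩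
  -- The walk stays in one component, and its i-th coordinate changes by at most 1 per step, hence
  -- takes all values 1, …, k. The component then has at least k > K points.
  have hwalk : ∀ y, Relation.ReflTransGen (BoardStep k fun x => Fin.castLE hcd (f (ι x))) x y →
      ι y ∈ (Subtype.val '' A.supp : Set (Fin d → ℤ)) ∧
      ∀ t, 1 ≤ t → t ≤ y i → (t : ℤ) ∈ (fun z : Fin d → ℤ => z i) '' (Subtype.val '' A.supp) := by
    intro y hxy
    induction hxy with
    | refl =>
      have h0 : ι x ∈ (Subtype.val '' A.supp : Set (Fin d → ℤ)) := ⟨⟨ι x, rfl⟩, rfl, rfl⟩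
      refine ⟨h0, fun t h1 h2 => ⟨ι x, h0, ?_⟩⟩
      have : x i = t := by omega
      simp [ι, this]
    | @tail b c _ hst ih =>
      obtain ⟨⟨⟨z, hzS⟩, hzA, hz⟩, ih2⟩ := ih
      simp only at hz
      subst hz
      have hcS : ι c ∈ S := by
        have h3 := Fin.castLE_injective hcd hst.2.2.1
        exact h3.symm.trans hzS
      have h0 : ι c ∈ (Subtype.val '' A.supp : Set (Fin d → ℤ)) := by
        refine ⟨⟨ι c, hcS⟩, ?_, rfl⟩
        rw [← hzA]
        refine SimpleGraph.ConnectedComponent.eq.2 (reachable_induce_of_near fun j => ?_)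
        have := hst.2.2.2 j
        rw [abs_le]
        simp only [ι]
        omega
      refine ⟨h0, fun t h1 h2 => ?_⟩
      by_cases ht : t ≤ b i
      · exact ih2 t h1 ht
      · have := hst.2.2.2 i
        refine ⟨ι c, h0, ?_⟩
        have : c i = t := by omega
        simp [ι, this]
  obtain ⟨hfin, hle⟩ := (hf (f (ι x))).1 A
  have hfin' : (Subtype.val '' A.supp : Set (Fin d → ℤ)).Finite := hfin.image _
  have hsub : ((fun t : ℕ => (t : ℤ)) '' (Finset.Icc 1 k : Set ℕ)) ⊆
      (fun z : Fin d → ℤ => z i) '' (Subtype.val '' A.supp) := by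
    rintro _ ⟨t, ht, rfl⟩
    rw [Finset.mem_coe, Finset.mem_Icc] at ht
    exact (hwalk y hxy).2 t ht.1 (hyi ▸ ht.2)
  have h1 := (ncard_le_ncard hsub (hfin'.image _)).trans (ncard_image_le hfin')
  rw [ncard_image_of_injective _ Nat.cast_injective, ncard_coe_finset, Nat.card_Icc,
    ncard_image_of_injective _ Subtype.val_injective] at h1
  have h2 : (k : ℝ) ≤ A.supp.ncard := by exact_mod_cast h1
  linarith

theorem factorial_mul_pow_mem_clusterConstants (d q : ℕ) (hq : 1 ≤ q) :
    ((d.factorial * q ^ d : ℕ) : ℝ) ∈ clusterConstants (gridGraph d) q (d + 1) := by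
  refine ⟨?_, exists_isClusteredColoring d q hq⟩
  have : 0 < d.factorial * q ^ d := Nat.mul_pos d.factorial_pos (by positivity)
  exact_mod_cast this

theorem clusteredChromaticNumber_gridGraph (d q : ℕ) (hq : 1 ≤ q) :
    clusteredChromaticNumber (gridGraph d) q = ((d + 1 : ℕ) : ℕ∞) := by
  refine le_antisymm ?_ ?_
  · exact iInf₂_le (d + 1) ⟨by omega, _, factorial_mul_pow_mem_clusterConstants d q hq⟩
  · refine le_iInf₂ fun c hc => ?_
    exact_mod_cast Nat.succ_le_of_lt (lt_of_clusterConstants_nonempty hc.2)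

theorem optimalClusterConstants_gridGraph (d q : ℕ) (hq : 1 ≤ q) :
    optimalClusterConstants (gridGraph d) q = clusterConstants (gridGraph d) q (d + 1) := by
  rw [optimalClusterConstants, clusteredChromaticNumber_gridGraph d q hq, ENat.toNat_natCast]

/-! ### From distance clustered colorings to level sets -/

theorem rConnected_supp {d : ℕ} {S : Set (Fin d → ℤ)}
    (A : ((gridGraph d).induce S).ConnectedComponent) :
    RConnected 1 (Subtype.val '' A.supp : Set (Fin d → ℤ)) := by
  rintro _ ⟨u, hu, rfl⟩ _ ⟨v, hv, rfl⟩
  obtain ⟨p⟩ := SimpleGraph.ConnectedComponent.exact (hu.trans hv.symm)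
  refine ⟨p.length, fun j => (p.getVert j : Fin d → ℤ), fun j => ⟨_, ?_, rfl⟩, by simp,
    by simp, fun j => ?_⟩
  · rw [← hu]
    exact SimpleGraph.ConnectedComponent.eq.2 (p.take j).reachable.symm
  · have h : (gridGraph d).Adj (p.getVert j) (p.getVert (j + 1)) := p.adj_getVert_succ j.2
    rw [dist_eq_norm]
    exact (show ‖_‖ = 1 from h).le

theorem edist_le_one {d : ℕ} {u v : Fin d → ℤ} (h : ‖u - v‖ ≤ 1) :
    (gridGraph d).edist u v ≤ 1 := by
  by_cases huv : u = v
  · rw [huv, SimpleGraph.edist_self]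
    exact zero_le
  · exact (SimpleGraph.edist_eq_one_iff_adj.2
      (gridGraph_adj_iff.2 ⟨huv, norm_sub_le_one_iff.1 h⟩)).le

/-- Two touching cubes are joined by a chain of at most `m + 1` steps between cubes with an at
least `m`-dimensional intersection. -/
theorem edist_le_of_touching {n m d k : ℕ} (hm : m < n) (hk : 1 ≤ k)
    (Φ : (Fin n → ℕ) → (Fin d → ℤ))
    (hΦ : ∀ x y, InBoard k x → InBoard k y →
      (m : WithBot ℕ∞) ≤ topDim (gridCube k x ∩ gridCube k y : Set (Fin n → ℝ)) →
        ‖Φ x - Φ y‖ ≤ 1)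
    {x y : Fin n → ℕ} (hx : InBoard k x) (hy : InBoard k y)
    (hxy : ∀ s, x s ≤ y s + 1 ∧ y s ≤ x s + 1) :
    (gridGraph d).edist (Φ x) (Φ y) ≤ ((m + 1 : ℕ) : ℕ∞) := by
  -- Coordinates are switched from x to y in blocks of n - m, so consecutive cubes agree in at least
  -- m coordinates. All are switched after m + 1 steps, because (m + 1)(n - m) ≥ n when m < n.
  let z : ℕ → Fin n → ℕ := fun t s => if (s : ℕ) < t * (n - m) then y s else x s
  have hz : ∀ t, InBoard k (z t) := by
    intro t s
    simp only [z]
    split_ifs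
    exacts [hy s, hx s]
  have hstep : ∀ t, (gridGraph d).edist (Φ (z t)) (Φ (z (t + 1))) ≤ 1 := by
    intro t
    refine edist_le_one (hΦ _ _ (hz t) (hz _) ?_)
    refine le_topDim_inter_gridCube hk (fun s => ?_)
      -- This injection skips the block being switched, so its values are coordinates left
      -- unchanged.
      (fun i : Fin m => if (i : ℕ) < t * (n - m) then ⟨i, by omega⟩ else ⟨i + (n - m), by omega⟩)
      (fun i j hij => ?_) fun i => ?_
    · have := hxy s
      simp only [z]
      split_ifs <;> omega
    · simp only at hij
      split_ifs at hij <;> simp only [Fin.mk.injEq] at hij <;> exact Fin.ext (by omega)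
    · simp only [z, add_mul, one_mul]
      split_ifs with h1 h2 h3 h4 <;> simp only at * <;> omega
  have hind : ∀ t : ℕ, (gridGraph d).edist (Φ x) (Φ (z t)) ≤ (t : ℕ∞) := by
    intro t
    induction t with
    | zero => simp [z]
    | succ t ih =>
      refine (SimpleGraph.edist_triangle (v := Φ (z t))).trans ?_
      push_cast
      exact add_le_add ih (hstep t)
  have hlast : z (m + 1) = y := by
    funext s
    simp only [z]
    rw [if_pos]
    refine s.2.trans_le ?_
    obtain ⟨a, rfl⟩ := Nat.exists_eq_add_of_lt hm
    rw [add_assoc, Nat.add_sub_cancel_left]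
    nlinarith
  rw [← hlast]
  exact hind _

/-! ### Unions of cubes along a king's walk. -/

theorem gridCube_subset_unitCube {n k : ℕ} (hk : 1 ≤ k) {x : Fin n → ℕ} (hx : InBoard k x) :
    gridCube k x ⊆ unitCube n := by
  intro z hz s _
  have hk' : (0 : ℝ) < k := by exact_mod_cast hk
  have h := (mem_gridCube hk).1 hz s
  have h1 : (1 : ℝ) ≤ x s := by exact_mod_cast (hx s).1
  have h2 : (x s : ℝ) ≤ k := by exact_mod_cast (hx s).2
  constructor
  · exact nonneg_of_mul_nonneg_right (by linarith) hk'
  · exact le_of_mul_le_mul_left (by linarith) hk'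

theorem isPreconnected_gridCube {n k : ℕ} (x : Fin n → ℕ) : IsPreconnected (gridCube k x) :=
  (convex_pi fun _ _ => convex_Icc _ _).isPreconnected

theorem gridCube_inter_nonempty {n k : ℕ} (hk : 1 ≤ k) {x y : Fin n → ℕ}
    (hxy : ∀ s, x s ≤ y s + 1 ∧ y s ≤ x s + 1) : (gridCube k x ∩ gridCube k y).Nonempty := by
  have hk' : (k : ℝ) ≠ 0 := by positivity
  refine ⟨fun s => ((min (x s) (y s) : ℕ) : ℝ) / k, (mem_gridCube hk).2 fun s => ?_,
    (mem_gridCube hk).2 fun s => ?_⟩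
  all_goals
    rw [mul_div_cancel₀ _ hk', sub_le_iff_le_add]
    have := hxy s
    constructor
    · exact_mod_cast (by omega)
    · exact_mod_cast (by omega)

theorem connectsOppositeFaces_iUnion {n k : ℕ} (hk : 1 ≤ k) {α : Type*} {f : (Fin n → ℕ) → α}
    {i : Fin n} {x y : Fin n → ℕ} (hx : InBoard k x) (hxi : x i = 1) (hy : InBoard k y)
    (hyi : y i = k) (hxy : Relation.ReflTransGen (BoardStep k f) x y) :
    ConnectsOppositeFaces
      (⋃ z ∈ {z | InBoard k z ∧ Relation.ReflTransGen (BoardStep k f) x z}, gridCube k z) := by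
  set U := ⋃ z ∈ {z | InBoard k z ∧ Relation.ReflTransGen (BoardStep k f) x z}, gridCube k z
    with hU
  have hk' : (k : ℝ) ≠ 0 := by positivity
  have hsub : ∀ z, InBoard k z → Relation.ReflTransGen (BoardStep k f) x z → gridCube k z ⊆ U :=
    fun z h1 h2 => subset_biUnion_of_mem (u := fun z => gridCube k z) (show z ∈ {z | _} from ⟨h1, h2⟩)
  have hx0 : (fun s => ((x s : ℝ) - 1) / k) ∈ gridCube k x := by
    rw [mem_gridCube hk]
    intro s
    rw [mul_div_cancel₀ _ hk']
    constructor <;> linarith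
  have hy1 : (fun s => (y s : ℝ) / k) ∈ gridCube k y := by
    rw [mem_gridCube hk]
    intro s
    rw [mul_div_cancel₀ _ hk']
    constructor <;> linarith
  -- Consecutive cubes of a walk share a point, so each reached cube lies with the starting cube in
  -- a preconnected subset of `U`.
  have hcon : ∀ z, Relation.ReflTransGen (BoardStep k f) x z →
      ∃ t ⊆ U, IsPreconnected t ∧ gridCube k x ⊆ t ∧ gridCube k z ⊆ t := by
    intro z hz
    induction hz with
    | refl => exact ⟨_, hsub x hx .refl, isPreconnected_gridCube x, Subset.rfl, Subset.rfl⟩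
    | @tail b c hxb hst ih =>
      obtain ⟨t, htU, ht, hxt, hbt⟩ := ih
      refine ⟨t ∪ gridCube k c, union_subset htU (hsub c hst.2.1 (hxb.tail hst)),
        ht.union' ?_ (isPreconnected_gridCube c), hxt.trans subset_union_left,
        subset_union_right⟩
      exact (gridCube_inter_nonempty hk hst.2.2.2).mono (inter_subset_inter_left _ hbt)
  refine ⟨iUnion₂_subset fun z hz => gridCube_subset_unitCube hk hz.1,
    ⟨⟨_, hsub x hx .refl hx0⟩, ?_⟩, i, ⟨_, hsub x hx .refl hx0, ?_⟩, _, hsub y hy hxy hy1, ?_⟩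
  · refine isPreconnected_of_forall (fun s => ((x s : ℝ) - 1) / k) fun w hw => ?_
    rw [hU] at hw
    simp only [mem_iUnion] at hw
    obtain ⟨z, hz, hwz⟩ := hw
    obtain ⟨t, htU, ht, hxt, hzt⟩ := hcon z hz.2
    exact ⟨t, htU, hxt hx0, hzt hwz, ht⟩
  · simp [hxi]
  · simp [hyi, hk']

/-- The distance condition does the work: consecutive cubes of a monochromatic walk have values at
distance at most m + 1, too close for two distinct components of a color class. -/
theorem levelProperty_of_isClusteredColoring {n m : ℕ} (hm : m < n) {K : ℝ}
    {f : (Fin (n - 1) → ℤ) → Fin n} (hf : IsClusteredColoring (gridGraph (n - 1)) (m + 1) f K) :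
    LevelProperty n m K := by
  classical
  intro k hk F hF
  let Q : ∀ x : Fin n → ℕ, InBoard k x → cubes n k := fun x hx => ⟨gridCube k x, x, hx, rfl⟩
  -- The value 0 off the board is irrelevant, since the walk never leaves the board.
  let Φ : (Fin n → ℕ) → (Fin (n - 1) → ℤ) := fun x => if h : InBoard k x then F (Q x h) else 0
  have hΦF : ∀ x (h : InBoard k x), Φ x = F (Q x h) := fun x h => dif_pos h
  have hΦ : ∀ x y, InBoard k x → InBoard k y →
      (m : WithBot ℕ∞) ≤ topDim (gridCube k x ∩ gridCube k y : Set (Fin n → ℝ)) →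
        ‖Φ x - Φ y‖ ≤ 1 := by
    intro x y hx hy h
    rw [hΦF x hx, hΦF y hy]
    exact hF _ _ h
  obtain ⟨i, x, y, hx, hxi, hy, hyi, hxy⟩ := exists_monochromatic_walk hk fun x => f (Φ x)
  let A := ((gridGraph (n - 1)).induce (f ⁻¹' {f (Φ x)})).connectedComponentMk ⟨Φ x, rfl⟩
  have hA : ∀ z, Relation.ReflTransGen (BoardStep k fun x => f (Φ x)) x z →
      ∃ h : f (Φ z) = f (Φ x), (⟨Φ z, h⟩ : f ⁻¹' {f (Φ x)}) ∈ A.supp := by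
    intro z hz
    induction hz with
    | refl => exact ⟨rfl, rfl⟩
    | @tail b c _ hst ih =>
      obtain ⟨hb, hbA⟩ := ih
      have hc : f (Φ c) = f (Φ x) := hst.2.2.1.symm.trans hb
      refine ⟨hc, ?_⟩
      by_contra hne
      have := (hf (f (Φ x))).2 A (SimpleGraph.connectedComponentMk _ ⟨Φ c, hc⟩)
        (fun e => hne e.symm) _ hbA _ rfl
      exact this.not_ge (edist_le_of_touching hm hk Φ hΦ hst.1 hst.2.1 hst.2.2.2)
  obtain ⟨hfin, hle⟩ := (hf (f (Φ x))).1 A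
  refine ⟨Subtype.val '' A.supp, rConnected_supp A, hfin.image _, ?_,
    {K | ∃ z, ∃ hz : InBoard k z, Relation.ReflTransGen (BoardStep k fun x => f (Φ x)) x z ∧
      K = Q z hz}, ?_, ?_⟩
  · rwa [ncard_image_of_injective _ Subtype.val_injective]
  · rintro _ ⟨z, hz, hxz, rfl⟩
    obtain ⟨h1, h2⟩ := hA z hxz
    exact ⟨_, h2, hΦF z hz⟩
  · convert connectsOppositeFaces_iUnion hk hx hxi hy hyi hxy using 1
    ext w
    simp only [mem_iUnion]
    constructor
    · rintro ⟨_, ⟨z, hz, hxz, rfl⟩, hw⟩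
      exact ⟨z, ⟨hz, hxz⟩, hw⟩
    · rintro ⟨z, ⟨hz, hxz⟩, hw⟩
      exact ⟨_, ⟨z, hz, hxz, rfl⟩, hw⟩

end ChessboardLevelSets

theorem mainTheorem4 (n m : ℕ) (hn : 1 ≤ n) (hm : m ≤ n - 1) :
    IsLeast (ChessboardLevelSets.levelConstants n m) (ChessboardLevelSets.optC n m) ∧
    ChessboardLevelSets.clusteredChromaticNumber
      (ChessboardLevelSets.gridGraph (n - 1)) (m + 1) ≠ ⊤ ∧
    IsLeast (ChessboardLevelSets.optimalClusterConstants
        (ChessboardLevelSets.gridGraph (n - 1)) (m + 1))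
      (ChessboardLevelSets.optK (ChessboardLevelSets.gridGraph (n - 1)) (m + 1)) ∧
    ChessboardLevelSets.optC n m ≤
      ChessboardLevelSets.optK (ChessboardLevelSets.gridGraph (n - 1)) (m + 1) ∧
    ChessboardLevelSets.optK (ChessboardLevelSets.gridGraph (n - 1)) (m + 1) ≤
      ((n - 1).factorial : ℝ) * ((m : ℝ) + 1) ^ (n - 1) := by
  have hcc := ChessboardLevelSets.optimalClusterConstants_gridGraph (n - 1) (m + 1) (by omega)
  have hmem := ChessboardLevelSets.factorial_mul_pow_mem_clusterConstants (n - 1) (m + 1) (by omega)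
  have hK : IsLeast (ChessboardLevelSets.optimalClusterConstants
        (ChessboardLevelSets.gridGraph (n - 1)) (m + 1))
      (ChessboardLevelSets.optK (ChessboardLevelSets.gridGraph (n - 1)) (m + 1)) := by
    rw [ChessboardLevelSets.optK, hcc]
    exact ChessboardLevelSets.isLeast_clusterConstants ⟨_, hmem⟩
  -- An optimal coloring of ℤ^(n-1) uses (n - 1) + 1 = n colors, exactly as many as the
  -- n-dimensional chessboard theorem allows.
  have hC : ChessboardLevelSets.optK (ChessboardLevelSets.gridGraph (n - 1)) (m + 1) ∈
      ChessboardLevelSets.levelConstants n m := by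
    have h := hK.1
    rw [hcc, Nat.sub_add_cancel hn] at h
    obtain ⟨hpos, f, hf⟩ := h
    exact ⟨hpos, ChessboardLevelSets.levelProperty_of_isClusteredColoring (by omega) hf⟩
  have hL := ChessboardLevelSets.isLeast_levelConstants ⟨_, hC⟩
  refine ⟨hL, ?_, hK, hL.2 hC, ?_⟩
  · rw [ChessboardLevelSets.clusteredChromaticNumber_gridGraph _ _ (by omega)]
    exact ENat.natCast_ne_top _
  · have := hK.2 (hcc ▸ hmem)
    push_cast at this
    exact this
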